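/- For integers $n,m\ge 1$ let $G_{n,m}=C_n\times P_m$ be the cylindrical graph: its vertices are the pairs $(i,j)$ with $i\in\mathbb{Z}_n$ and $0\le j\le m-1$, and its edges are the ring edges $\{(i,j),(i+1 \bmod n,j)\}$ and the path edges $\{(i,j),(i,j+1)\}$. Write $R_k=\{(i,k): i\in\mathbb{Z}_n\}$ for the $k$-th ring. Let $G^s_{n,m}$ be the graph obtained from $G_{n,m}$ by adding a new vertex $s$ (the sink) and joining it by an edge to every vertex of $R_0\cup R_{m-1}$. For a spanning tree $T$ of $G^s_{n,m}$, let the left segment $T_{\mathrm l}$ (respectively the right segment $T_{\mathrm r}$) be the set of vertices $v\neq s$ whose path to $s$ in $T$ has as its last edge an edge between $s$ and $R_0$ (respectively between $s$ and $R_{m-1}$), and let the LR-Slash of $T$ be the set of edges of $G^s_{n,m}$ $$\mathrm{Slash}_{LR}(T)=\{uv\in E(G^s_{n,m}) : u\in T_{\mathrm l},\ v\in T_{\mathrm r}\}.$$ Theorem. For every $n$ there exist constants $C=C(n)>0$ and $\delta=\delta(n)\in(0,1)$, depending only on $n$, such that for every $m$ and every real $l>0$, if $T$ is a uniformly random spanning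 tree of $G^s_{n,m}$, then $$\mathbb{P}\bigl(|\mathrm{Slash}_{LR}(T)|>l\bigr)\le C\,\delta^{\,l}.$$ -/

import Mathlib

open scoped SimpleGraph

/-- The cylinder `C_n × P_m`: the vertex `(i, j)` lies at angular position `i` on the `j`-th ring. -/
def cylinder (n m : ℕ) : SimpleGraph (Fin n × Fin m) :=
  SimpleGraph.cycleGraph n □ SimpleGraph.pathGraph m

/-- Vertices of the cylinder with a sink: `none` is the sink `s`, `some v` is a vertex `v` of
the cylinder. -/
abbrev WiredVertex (n m : ℕ) : Type := Option (Fin n × Fin m)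

/-- The `k`-th ring `R_k` of the cylinder. -/
def ring (n m k : ℕ) : Set (Fin n × Fin m) := {v | (v.2 : ℕ) = k}

/-- The left boundary ring `R_0`. -/
def leftRing (n m : ℕ) : Set (Fin n × Fin m) := ring n m 0

/-- The right boundary ring `R_{m-1}`. -/
def rightRing (n m : ℕ) : Set (Fin n × Fin m) := ring n m (m - 1)

/-- Adjacency in the cylinder with a sink: the edges of the cylinder, and one edge from the sink to
every vertex of the two boundary rings. -/
def wiredAdj (n m : ℕ) : WiredVertex n m → WiredVertex n m → Prop
  | some u, some v => (cylinder n m).Adj u v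
  | none, some v => v ∈ leftRing n m ∪ rightRing n m
  | some u, none => u ∈ leftRing n m ∪ rightRing n m
  | none, none => False

/-- The cylinder with a sink, `G^s_{n,m}`. -/
def wiredCylinder (n m : ℕ) : SimpleGraph (WiredVertex n m) where
  Adj := wiredAdj n m
  symm := ⟨by
    rintro (_ | u) (_ | v) h
    · exact h
    · exact h
    · exact h
    · exact SimpleGraph.Adj.symm (G := cylinder n m) h⟩
  loopless := ⟨by
    rintro (_ | u) h
    · exact h
    · exact (cylinder n m).loopless.irrefl u h⟩

/-- Every vertex of the cylinder with a sink is connected to the sink along its line. -/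
theorem wiredCylinder_connected (n m : ℕ) : (wiredCylinder n m).Connected := by
  have key : ∀ (j : ℕ) (hj : j < m) (i : Fin n),
      (wiredCylinder n m).Reachable (some (i, ⟨j, hj⟩)) none := by
    intro j
    induction j with
    | zero =>
      intro hj i
      have h : (wiredCylinder n m).Adj (some (i, ⟨0, hj⟩)) none := Or.inl rfl
      exact h.reachable
    | succ k ih =>
      intro hj i
      have h : (wiredCylinder n m).Adj (some (i, ⟨k + 1, hj⟩)) (some (i, ⟨k, by omega⟩)) := by
        change (cylinder n m).Adj _ _
        simp [cylinder, SimpleGraph.boxProd_adj, SimpleGraph.pathGraph_adj]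
      exact h.reachable.trans (ih (by omega) i)
  have key' : ∀ x, (wiredCylinder n m).Reachable x none := by
    rintro (_ | ⟨i, j, hj⟩)
    · exact SimpleGraph.Reachable.refl _
    · exact key j hj i
  have : Nonempty (WiredVertex n m) := ⟨none⟩
  exact ⟨fun x y => (key' x).trans (key' y).symm⟩

/-- The set of spanning trees of a graph `G`, as graphs on the vertex set of `G`. -/
def spanningTrees {V : Type*} (G : SimpleGraph V) : Set (SimpleGraph V) :=
  {T | T ≤ G ∧ T.IsTree}

open Classical in
/-- The law of the uniform spanning tree of a finite connected graph. -/
noncomputable def ust {V : Type*} [Fintype V] (G : SimpleGraph V) (hG : G.Connected) :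
    PMF (SimpleGraph V) :=
  PMF.uniformOfFinset (spanningTrees G).toFinset
    (Set.toFinset_nonempty.mpr hG.exists_isTree_le)

/-- The vertices `v` whose path to the sink in `T` ends with an edge from a vertex of `R`
to the sink. (The sink itself is not such a vertex.) -/
def segmentThrough {n m : ℕ} (R : Set (Fin n × Fin m)) (T : SimpleGraph (WiredVertex n m)) :
    Set (WiredVertex n m) :=
  {v | ∃ p : T.Walk v none, p.IsPath ∧ ∃ w ∈ R, p.penultimate = some w}

/-- The vertex set of the left segment of `T`. -/
def leftSegment {n m : ℕ} (T : SimpleGraph (WiredVertex n m)) : Set (WiredVertex n m) :=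
  segmentThrough (leftRing n m) T

/-- The vertex set of the right segment of `T`. -/
def rightSegment {n m : ℕ} (T : SimpleGraph (WiredVertex n m)) : Set (WiredVertex n m) :=
  segmentThrough (rightRing n m) T

/-- The LR-Slash of `T`: the edges of the cylinder with a sink that join a vertex of the left
segment to a vertex of the right segment. -/
def slashLR {n m : ℕ} (T : SimpleGraph (WiredVertex n m)) : Set (Sym2 (WiredVertex n m)) :=
  {e | e ∈ (wiredCylinder n m).edgeSet ∧
    ∃ u ∈ leftSegment T, ∃ v ∈ rightSegment T, e = s(u, v)}

/-! A spanning tree rooted at the sink is a parent map. Write A, b, K for `leftReach`, `rightReach`,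
`cleanCut`. A slash edge has its left end in the rings from b - 1 to A - 1, so an exponential tail
for A - b suffices.

Such tails come from surgery on one ring. Suppose any tree whose statistic exceeds i can be brought
to the value i by changing parents in a single ring that can be read off the result. This surgery is
at most M-to-one with M = (3n+1)^n, so trees with statistic > i number at most M times those with
value i, and the tail decays with ratio M/(M+1).

Cutting back the right segment hands branches to the left one and may increase A, so A is no fixed
reference. The first clean cut K ≥ A is one: no path crosses it leftwards, so the new left vertices
stay below K. `exists_cleanCut_eq` controls K - A, and `exists_rightReach_eq` controls K - b when K
- A ≤ i. If A - b ≥ 2i, then K - A ≥ i, or K - A ≤ i and K - b ≥ 2i. -/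

/-! ### Rooted trees as parent maps -/

/-- The vertices of the cylinder. -/
abbrev CylVertex (n m : ℕ) : Type := Fin n × Fin m

/-- A parent map: it sends every vertex of the cylinder to its parent, where `none` is the sink. -/
abbrev ParentMap (n m : ℕ) : Type := CylVertex n m → Option (CylVertex n m)

/-- `w` lies on the path that starts at `v` and follows the parent map `p`. -/
def Anc {n m : ℕ} (p : ParentMap n m) : CylVertex n m → CylVertex n m → Prop :=
  Relation.ReflTransGen fun v w => p v = some w

/-- Parent maps of the spanning trees of the cylinder with a sink, rooted at the sink. -/
structure IsArborescence {n m : ℕ} (p : ParentMap n m) : Prop where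
  adj : ∀ v, (wiredCylinder n m).Adj (some v) (p v)
  rooted : ∀ v, ∃ w, Anc p v w ∧ p w = none

/-- The path from `v` along `p` enters the sink from the ring `k`. -/
def EndsAt {n m : ℕ} (p : ParentMap n m) (k : ℕ) (v : CylVertex n m) : Prop :=
  ∃ w, Anc p v w ∧ p w = none ∧ (w.2 : ℕ) = k

/-- The path from `v` along `p` visits a ring to the left of the ring `c`. -/
def Dips {n m : ℕ} (p : ParentMap n m) (c : ℕ) (v : CylVertex n m) : Prop :=
  ∃ w, Anc p v w ∧ (w.2 : ℕ) < c

/-- No step of `p` leads from the rings `≥ c` to the rings `< c`. -/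
def IsCleanCut {n m : ℕ} (p : ParentMap n m) (c : ℕ) : Prop :=
  ∀ v w, p v = some w → c ≤ (v.2 : ℕ) → c ≤ (w.2 : ℕ)

theorem wiredCylinder_adj_some_level {n m : ℕ} {v w : CylVertex n m}
    (h : (wiredCylinder n m).Adj (some v) (some w)) :
    (v.2 : ℕ) ≤ w.2 + 1 ∧ (w.2 : ℕ) ≤ v.2 + 1 := by
  have h' : (cylinder n m).Adj v w := h
  simp only [cylinder, SimpleGraph.boxProd_adj, SimpleGraph.pathGraph_adj] at h'
  rcases h' with ⟨-, h⟩ | ⟨h, -⟩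
  · rw [h]; omega
  · omega

theorem wiredCylinder_adj_finRotate {n m : ℕ} (hn : 2 ≤ n) (v : CylVertex n m) :
    (wiredCylinder n m).Adj (some v) (some (finRotate n v.1, v.2)) := by
  change (cylinder n m).Adj _ _
  obtain ⟨k, rfl⟩ : ∃ k, n = k + 2 := ⟨n - 2, by omega⟩
  simp only [cylinder, SimpleGraph.boxProd_adj, and_true, finRotate_apply]
  left
  rw [SimpleGraph.cycleGraph_adj]
  right
  simp

section Anc

variable {n m : ℕ} {p : ParentMap n m} {v w x : CylVertex n m}

theorem Anc.refl (v : CylVertex n m) : Anc p v v := Relation.ReflTransGen.refl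

theorem Anc.trans (h : Anc p v w) (h' : Anc p w x) : Anc p v x := Relation.ReflTransGen.trans h h'

theorem Anc.head (h : p v = some w) (h' : Anc p w x) : Anc p v x := Relation.ReflTransGen.head h h'

theorem Anc.single (h : p v = some w) : Anc p v w := Anc.head h (Anc.refl w)

theorem Anc.total (h : Anc p v w) (h' : Anc p v x) : Anc p w x ∨ Anc p x w :=
  Relation.ReflTransGen.total_of_right_unique
    (fun a b c (hb : p a = some b) (hc : p a = some c) => Option.some.inj (hb.symm.trans hc)) h h'

theorem Anc.eq_of_none (h : Anc p v w) (hv : p v = none) : w = v := by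
  rcases Relation.ReflTransGen.cases_head h with h | ⟨y, hy, -⟩
  · exact h.symm
  · rw [hv] at hy; cases hy

theorem EndsAt.of_anc {k : ℕ} (h : Anc p v w) (hw : EndsAt p k w) : EndsAt p k v := by
  obtain ⟨x, hx, h1, h2⟩ := hw
  exact ⟨x, h.trans hx, h1, h2⟩

theorem EndsAt.anc {k : ℕ} (hv : EndsAt p k v) (h : Anc p v w) : EndsAt p k w := by
  obtain ⟨x, hx, h1, h2⟩ := hv
  rcases hx.total h with h' | h'
  · rw [h'.eq_of_none h1]; exact ⟨x, Anc.refl x, h1, h2⟩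
  · exact ⟨x, h', h1, h2⟩

theorem EndsAt.unique {k l : ℕ} (h : EndsAt p k v) (h' : EndsAt p l v) : k = l := by
  obtain ⟨x, hx, h1, h2⟩ := h
  obtain ⟨y, hy, h3, h4⟩ := h'.anc hx
  rw [hy.eq_of_none h1] at h4
  omega

theorem Dips.of_anc {c : ℕ} (h : Anc p v w) (hw : Dips p c w) : Dips p c v := by
  obtain ⟨x, hx, h1⟩ := hw
  exact ⟨x, h.trans hx, h1⟩

theorem IsCleanCut.le_of_anc {c : ℕ} (hc : IsCleanCut p c) (h : Anc p v w) (hv : c ≤ (v.2 : ℕ)) :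
    c ≤ (w.2 : ℕ) := by
  induction h with
  | refl => exact hv
  | tail _ h ih => exact hc _ _ h ih

theorem isCleanCut_self (p : ParentMap n m) : IsCleanCut p m := by
  intro v w _ hv
  have := v.2.isLt
  omega

end Anc

namespace IsArborescence

variable {n m : ℕ} {p : ParentMap n m} {v w x : CylVertex n m}

theorem level (hp : IsArborescence p) (h : p v = some w) :
    (v.2 : ℕ) ≤ w.2 + 1 ∧ (w.2 : ℕ) ≤ v.2 + 1 :=
  wiredCylinder_adj_some_level (h ▸ hp.adj v)

theorem level_of_none (hp : IsArborescence p) (h : p v = none) :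
    (v.2 : ℕ) = 0 ∨ (v.2 : ℕ) = m - 1 := by
  have := hp.adj v
  rw [h] at this
  exact this

theorem endsAt_or (hp : IsArborescence p) (v : CylVertex n m) :
    EndsAt p 0 v ∨ EndsAt p (m - 1) v := by
  obtain ⟨w, hw, h⟩ := hp.rooted v
  rcases hp.level_of_none h with h' | h'
  · exact Or.inl ⟨w, hw, h, h'⟩
  · exact Or.inr ⟨w, hw, h, h'⟩

/-- A path between two rings visits every ring in between. -/
theorem exists_anc_level (hp : IsArborescence p) (h : Anc p v w) {j : ℕ}
    (hj : ((v.2 : ℕ) ≤ j ∧ j ≤ w.2) ∨ ((w.2 : ℕ) ≤ j ∧ j ≤ v.2)) :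
    ∃ x, Anc p v x ∧ (x.2 : ℕ) = j := by
  induction h using Relation.ReflTransGen.head_induction_on with
  | refl => exact ⟨w, Anc.refl w, by omega⟩
  | @head a b hab _ ih =>
    have := hp.level hab
    by_cases ha : (a.2 : ℕ) = j
    · exact ⟨a, Anc.refl a, ha⟩
    · obtain ⟨x, hx, h⟩ := ih (by omega)
      exact ⟨x, Anc.head hab hx, h⟩

/-- A path ending in the rings `≥ c` either stays there, or enters them for the last time in
the ring `c`. -/
theorem not_dips_or_exists (hp : IsArborescence p) (h : Anc p v w) (hw : p w = none) {c : ℕ}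
    (hc : c ≤ (w.2 : ℕ)) :
    ¬ Dips p c v ∨ ∃ x, Anc p v x ∧ (x.2 : ℕ) = c ∧ ¬ Dips p c x := by
  induction h using Relation.ReflTransGen.head_induction_on with
  | refl =>
    left
    rintro ⟨x, hx, h⟩
    rw [hx.eq_of_none hw] at h
    omega
  | @head a b hab _ ih =>
    have hl := hp.level hab
    rcases ih with ih | ⟨x, hx, h⟩
    · have hb : c ≤ (b.2 : ℕ) := by
        by_contra hb
        exact ih ⟨b, Anc.refl b, by omega⟩
      by_cases ha : c ≤ (a.2 : ℕ)
      · left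
        rintro ⟨x, hx, h⟩
        rcases Relation.ReflTransGen.cases_head hx with rfl | ⟨y, hy, hyx⟩
        · omega
        · have hyb : y = b := Option.some.inj (hy.symm.trans hab)
          subst hyb
          exact ih ⟨x, hyx, h⟩
      · exact Or.inr ⟨b, Anc.single hab, by omega, ih⟩
    · exact Or.inr ⟨x, Anc.head hab hx, h⟩

end IsArborescence

/-! ### Rerouting along a ring -/

section Reroute

open Classical in
/-- Turn the vertices of the ring `c` outside `G` along the ring. -/
noncomputable def reroute {n m : ℕ} (p : ParentMap n m) (G : Set (CylVertex n m)) (c : ℕ) :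
    ParentMap n m :=
  fun v => if (v.2 : ℕ) = c ∧ v ∉ G then some (finRotate n v.1, v.2) else p v

variable {n m : ℕ} {p : ParentMap n m} {G : Set (CylVertex n m)} {c : ℕ} {v w x : CylVertex n m}

theorem reroute_of_ne (h : (v.2 : ℕ) ≠ c) : reroute p G c v = p v := by
  simp [reroute, h]

theorem reroute_of_notMem (h : (v.2 : ℕ) = c) (h' : v ∉ G) :
    reroute p G c v = some (finRotate n v.1, v.2) := by
  simp [reroute, h, h']

theorem reroute_of_not (h : ¬ ((v.2 : ℕ) = c ∧ v ∉ G)) : reroute p G c v = p v := by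
  simp only [reroute, if_neg h]

theorem anc_reroute (h : Anc p v w) (hv : ∀ x, Anc p v x → ¬ ((x.2 : ℕ) = c ∧ x ∉ G)) :
    Anc (reroute p G c) v w := by
  induction h using Relation.ReflTransGen.head_induction_on with
  | refl => exact Anc.refl w
  | @head a b hab _ ih =>
    refine Anc.head (w := b) ?_ (ih fun x hx => hv x (Anc.head hab hx))
    rw [reroute_of_not (hv a (Anc.refl a))]
    exact hab

theorem endsAt_reroute {k : ℕ} (h : EndsAt p k v)
    (hv : ∀ x, Anc p v x → ¬ ((x.2 : ℕ) = c ∧ x ∉ G)) : EndsAt (reroute p G c) k v := by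
  obtain ⟨w, hw, h1, h2⟩ := h
  exact ⟨w, anc_reroute hw hv, (reroute_of_not (hv w hw)).trans h1, h2⟩

theorem mem_of_anc (hG : ∀ v w, v ∈ G → p v = some w → w ∈ G) (hv : v ∈ G) (h : Anc p v w) :
    w ∈ G := by
  induction h with
  | refl => exact hv
  | tail _ h ih => exact hG _ _ ih h

theorem endsAt_reroute_of_mem {k : ℕ} (hG : ∀ v w, v ∈ G → p v = some w → w ∈ G) (hv : v ∈ G)
    (h : EndsAt p k v) : EndsAt (reroute p G c) k v :=
  endsAt_reroute h fun _ hx h' => h'.2 (mem_of_anc hG hv hx)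

theorem exists_finRotate_iterate (i j : Fin n) : ∃ k : ℕ, (finRotate n)^[k] i = j := by
  obtain ⟨l, rfl⟩ : ∃ l, n = l + 1 := ⟨n - 1, by have := i.isLt; omega⟩
  have key : ∀ k : ℕ, ((finRotate (l + 1))^[k] i : ℕ) = (i + k) % (l + 1) := by
    intro k
    induction k with
    | zero => simp [Nat.mod_eq_of_lt i.isLt]
    | succ k ih =>
      rw [Function.iterate_succ_apply', finRotate_apply, Fin.val_add, ih, Fin.val_one', ← Nat.add_mod,
        Nat.add_assoc]
  refine ⟨j + (l + 1 - i), Fin.ext ?_⟩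
  rw [key, show (i : ℕ) + (j + (l + 1 - i)) = j + (l + 1) by omega, Nat.add_mod_right,
    Nat.mod_eq_of_lt j.isLt]

theorem exists_anc_reroute_ring (hx : (x.2 : ℕ) = c) (hg : ∃ g ∈ G, (g.2 : ℕ) = c) :
    ∃ y ∈ G, (y.2 : ℕ) = c ∧ Anc (reroute p G c) x y := by
  obtain ⟨g, hg, hgc⟩ := hg
  obtain ⟨k, hk⟩ := exists_finRotate_iterate x.1 g.1
  have hgx : ((finRotate n)^[k] x.1, x.2) ∈ G := by
    have : ((finRotate n)^[k] x.1, x.2) = g := Prod.ext hk (Fin.ext (hx.trans hgc.symm))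
    rwa [this]
  clear hk
  induction k generalizing x with
  | zero => exact ⟨x, hgx, hx, Anc.refl x⟩
  | succ k ih =>
    by_cases h : x ∈ G
    · exact ⟨x, h, hx, Anc.refl x⟩
    · obtain ⟨y, hy, hyc, hxy⟩ := ih (x := (finRotate n x.1, x.2)) hx
        (by simpa [Function.iterate_succ_apply] using hgx)
      exact ⟨y, hy, hyc, Anc.head (reroute_of_notMem hx h) hxy⟩

theorem exists_anc_reroute (hg : ∃ g ∈ G, (g.2 : ℕ) = c) (h : Anc p v x) (hx : (x.2 : ℕ) = c) :
    ∃ y ∈ G, (y.2 : ℕ) = c ∧ Anc (reroute p G c) v y := by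
  induction h using Relation.ReflTransGen.head_induction_on with
  | refl => exact exists_anc_reroute_ring hx hg
  | @head a b hab _ ih =>
    by_cases ha : (a.2 : ℕ) = c
    · exact exists_anc_reroute_ring ha hg
    · obtain ⟨y, hy, hyc, hby⟩ := ih
      exact ⟨y, hy, hyc, Anc.head ((reroute_of_ne ha).trans hab) hby⟩

/-- No cycle arises: a turned vertex follows the ring until it meets `G`, and from there the path
stays in `G`, where no parent has changed. -/
theorem IsArborescence.reroute (hp : IsArborescence p)
    (hG : ∀ v w, v ∈ G → p v = some w → w ∈ G) (hg : ∃ g ∈ G, (g.2 : ℕ) = c) :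
    IsArborescence (reroute p G c) where
  adj v := by
    by_cases h : (v.2 : ℕ) = c ∧ v ∉ G
    · rw [reroute_of_notMem h.1 h.2]
      refine wiredCylinder_adj_finRotate ?_ v
      obtain ⟨g, hg, hgc⟩ := hg
      -- With only one angle, the ring is a single vertex, which already lies in `G`.
      by_contra hn
      have hvg : v = g := by
        refine Prod.ext (Fin.ext ?_) (Fin.ext (h.1.trans hgc.symm))
        have := v.1.isLt
        have := g.1.isLt
        omega
      exact h.2 (hvg ▸ hg)
    · rw [reroute_of_not h]; exact hp.adj v
  rooted v := by
    have key : ∃ k, EndsAt (_root_.reroute p G c) k v := by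
      by_cases h : ∀ x, Anc p v x → ¬ ((x.2 : ℕ) = c ∧ x ∉ G)
      · rcases hp.endsAt_or v with h' | h'
        · exact ⟨_, endsAt_reroute h' h⟩
        · exact ⟨_, endsAt_reroute h' h⟩
      · push Not at h
        obtain ⟨x, hx, hxc, -⟩ := h
        obtain ⟨y, hy, -, hvy⟩ := exists_anc_reroute hg hx hxc
        rcases hp.endsAt_or y with h' | h'
        · exact ⟨_, (endsAt_reroute_of_mem hG hy h').of_anc hvy⟩
        · exact ⟨_, (endsAt_reroute_of_mem hG hy h').of_anc hvy⟩
    obtain ⟨k, w, hw, h, -⟩ := key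
    exact ⟨w, hw, h⟩

end Reroute

/-! ### Extents of the segments and the first clean cut -/

section Statistics

variable {n m : ℕ}

/-- All vertices of the left segment lie in the rings `< leftReach p`. -/
noncomputable def leftReach (p : ParentMap n m) : ℕ :=
  sInf {j | ∀ v, EndsAt p 0 v → (v.2 : ℕ) < j}

/-- The first ring that the right segment meets, or `m` if the right segment is empty. -/
noncomputable def rightReach (p : ParentMap n m) : ℕ :=
  sInf {j | j = m ∨ ∃ v, EndsAt p (m - 1) v ∧ (v.2 : ℕ) = j}

/-- The first clean cut to the right of the left segment. -/
noncomputable def cleanCut (p : ParentMap n m) : ℕ :=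
  sInf {c | leftReach p ≤ c ∧ IsCleanCut p c}

variable {p : ParentMap n m} {v : CylVertex n m}

theorem lt_leftReach (h : EndsAt p 0 v) : (v.2 : ℕ) < leftReach p :=
  Nat.sInf_mem (s := {j | ∀ v, EndsAt p 0 v → (v.2 : ℕ) < j}) ⟨m, fun v _ => v.2.isLt⟩ v h

theorem leftReach_le {j : ℕ} (h : ∀ v, EndsAt p 0 v → (v.2 : ℕ) < j) : leftReach p ≤ j :=
  Nat.sInf_le h

theorem exists_of_lt_leftReach {j : ℕ} (h : j < leftReach p) :
    ∃ v, EndsAt p 0 v ∧ j ≤ (v.2 : ℕ) := by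
  by_contra! h'
  exact absurd (leftReach_le h') (by omega)

theorem rightReach_le (h : EndsAt p (m - 1) v) : rightReach p ≤ v.2 :=
  Nat.sInf_le (Or.inr ⟨v, h, rfl⟩)

theorem exists_of_rightReach_lt (h : rightReach p < m) :
    ∃ v, EndsAt p (m - 1) v ∧ (v.2 : ℕ) = rightReach p := by
  rcases Nat.sInf_mem (s := {j | j = m ∨ ∃ v, EndsAt p (m - 1) v ∧ (v.2 : ℕ) = j})
    ⟨m, Or.inl rfl⟩ with h' | h'
  · exact absurd h' h.ne
  · exact h'

theorem cleanCut_spec (p : ParentMap n m) : leftReach p ≤ cleanCut p ∧ IsCleanCut p (cleanCut p) :=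
  Nat.sInf_mem (s := {c | leftReach p ≤ c ∧ IsCleanCut p c})
    ⟨m, leftReach_le fun v _ => v.2.isLt, isCleanCut_self p⟩

theorem cleanCut_le {c : ℕ} (h : leftReach p ≤ c) (h' : IsCleanCut p c) : cleanCut p ≤ c :=
  Nat.sInf_le ⟨h, h'⟩

theorem cleanCut_le_self (p : ParentMap n m) : cleanCut p ≤ m :=
  cleanCut_le (leftReach_le fun v _ => v.2.isLt) (isCleanCut_self p)

end Statistics

/-! ### One-ring surgeries -/

section Surgery

variable {n m : ℕ} {p : ParentMap n m}

/-- Between the left segment and the first clean cut, any ring can be made a clean cut by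
changing the parents in that ring only. -/
theorem exists_cleanCut_eq (hm : 2 ≤ m) (hp : IsArborescence p) {c : ℕ}
    (hc : leftReach p ≤ c) (hc' : c < cleanCut p) :
    ∃ q, IsArborescence q ∧ leftReach q = leftReach p ∧ cleanCut q = c ∧
      ∀ v, (v.2 : ℕ) ≠ c → p v = q v := by
  have hright : ∀ v, c ≤ (v.2 : ℕ) → EndsAt p (m - 1) v := fun v hv =>
    (hp.endsAt_or v).resolve_left fun h => by have := lt_leftReach h; omega
  have hdirty : ¬ IsCleanCut p c := fun h => by have := cleanCut_le hc h; omega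
  set G : Set (CylVertex n m) := {v | ¬ Dips p c v} with hGdef
  have hG : ∀ v w, v ∈ G → p v = some w → w ∈ G :=
    fun v w hv h hw => hv (hw.of_anc (Anc.single h))
  -- A step crossing `c` leftwards starts in the right segment, so its path must come back; its last
  -- entry point in ring `c` lies in `G`.
  have hg : ∃ g ∈ G, (g.2 : ℕ) = c := by
    simp only [IsCleanCut, not_forall] at hdirty
    obtain ⟨v, w, hvw, hv, hw⟩ := hdirty
    have hl := hp.level hvw
    obtain ⟨t, ht, h1, h2⟩ := hright v hv
    have := v.2.isLt
    rcases hp.not_dips_or_exists ht h1 (c := c) (by omega) with h | ⟨x, -, hx, h⟩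
    · exact absurd ⟨w, Anc.single hvw, by omega⟩ h
    · exact ⟨x, h, hx⟩
  have hq := hp.reroute hG hg
  refine ⟨reroute p G c, hq, ?_, ?_, fun v hv => (reroute_of_ne hv).symm⟩
  all_goals
    -- Left paths stay in rings `< c` and are untouched; a path that meets ring `c` ends in a right
    -- vertex of `G`.
    have hleft : ∀ v, EndsAt (reroute p G c) 0 v ↔ EndsAt p 0 v := by
      intro v
      have hfwd : EndsAt p 0 v → EndsAt (reroute p G c) 0 v := fun h =>
        endsAt_reroute h fun x hx hxc => by
          have := lt_leftReach (h.anc hx)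
          omega
      refine ⟨fun h => ?_, hfwd⟩
      by_contra h'
      have hr := (hp.endsAt_or v).resolve_left h'
      have hr' : EndsAt (reroute p G c) (m - 1) v := by
        by_cases hB : ∀ x, Anc p v x → ¬ ((x.2 : ℕ) = c ∧ x ∉ G)
        · exact endsAt_reroute hr hB
        · push Not at hB
          obtain ⟨x, hx, hxc, -⟩ := hB
          obtain ⟨y, hy, hyc, hvy⟩ := exists_anc_reroute (p := p) hg hx hxc
          exact (endsAt_reroute_of_mem hG hy (hright y hyc.ge)).of_anc hvy
      have := h.unique hr'
      omega
    have hL : leftReach (reroute p G c) = leftReach p := by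
      simp only [leftReach, hleft]
  · exact hL
  · apply le_antisymm
    · refine cleanCut_le (hL ▸ hc) fun v w h hv => ?_
      by_cases hB : (v.2 : ℕ) = c ∧ v ∉ G
      · rw [reroute_of_notMem hB.1 hB.2] at h
        cases h
        exact hv
      · rw [reroute_of_not hB] at h
        -- A step crossing `c` leftwards starts in ring `c` outside `G`, and those vertices were
        -- turned.
        by_contra hw
        have := hp.level h
        exact hB ⟨by omega, fun hvG => hvG ⟨w, Anc.single h, by omega⟩⟩
    · by_contra! hlt
      obtain ⟨h1, h2⟩ := cleanCut_spec (reroute p G c)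
      rw [hL] at h1
      -- A crossing of an earlier cut starts in a ring before `c`, where parents are unchanged.
      have : IsCleanCut p (cleanCut (reroute p G c)) := by
        intro v w h hv
        by_contra hw
        have := hp.level h
        exact hw (h2 v w ((reroute_of_ne (by omega)).trans h) hv)
      have := cleanCut_le h1 this
      omega

/-- The right segment can be cut back to any ring that the left segment overlaps by changing the
parents in the preceding ring only. -/
theorem exists_rightReach_eq (hm : 2 ≤ m) (hp : IsArborescence p) {c : ℕ}
    (hb : rightReach p < c) (hA : c ≤ leftReach p) (hcm : c < m) :
    ∃ q, IsArborescence q ∧ leftReach p ≤ leftReach q ∧ cleanCut q = cleanCut p ∧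
      rightReach q = c ∧ ∀ v, (v.2 : ℕ) ≠ c - 1 → p v = q v := by
  set G : Set (CylVertex n m) := {v | EndsAt p 0 v} with hGdef
  have hG : ∀ v w, v ∈ G → p v = some w → w ∈ G :=
    fun v w hv h => EndsAt.anc hv (Anc.single h)
  -- A left path from a ring `≥ c - 1` to ring 0 passes through ring `c - 1`.
  have hg : ∃ g ∈ G, (g.2 : ℕ) = c - 1 := by
    obtain ⟨v, hv, hvc⟩ := exists_of_lt_leftReach (p := p) (j := c - 1) (by omega)
    obtain ⟨t, ht, h1, h2⟩ := id hv
    obtain ⟨x, hx, hxc⟩ := hp.exists_anc_level ht (j := c - 1) (by omega)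
    exact ⟨x, hv.anc hx, hxc⟩
  have hq := hp.reroute hG hg
  have hleft : ∀ v, EndsAt p 0 v → EndsAt (reroute p G (c - 1)) 0 v :=
    fun v hv => endsAt_reroute_of_mem hG hv hv
  -- A newly left vertex had a path meeting ring `c - 1`, which no path from beyond the clean cut
  -- can do.
  have hleft' : ∀ v, EndsAt (reroute p G (c - 1)) 0 v → (v.2 : ℕ) < cleanCut p := by
    intro v hv
    obtain ⟨h1, h2⟩ := cleanCut_spec p
    by_cases hB : ∀ x, Anc p v x → ¬ ((x.2 : ℕ) = c - 1 ∧ x ∉ G)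
    · rcases hp.endsAt_or v with h | h
      · have := lt_leftReach h; omega
      · have := hv.unique (endsAt_reroute h hB); omega
    · push Not at hB
      obtain ⟨x, hx, hxc, -⟩ := hB
      by_contra! hle
      have := h2.le_of_anc hx hle
      omega
  have hL : leftReach p ≤ leftReach (reroute p G (c - 1)) :=
    leftReach_le fun v hv => lt_leftReach (hleft v hv)
  have hclean : ∀ d, c ≤ d → (IsCleanCut (reroute p G (c - 1)) d ↔ IsCleanCut p d) := by
    intro d hd
    constructor
    · intro h v w hvw hv
      exact h v w ((reroute_of_ne (by omega)).trans hvw) hv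
    · intro h v w hvw hv
      rw [reroute_of_ne (by omega)] at hvw
      exact h v w hvw hv
  have hcut := cleanCut_spec p
  have hcut' := cleanCut_spec (reroute p G (c - 1))
  refine ⟨reroute p G (c - 1), hq, hL, ?_, ?_, fun v hv => (reroute_of_ne hv).symm⟩
  · exact le_antisymm
      (cleanCut_le (leftReach_le hleft') ((hclean _ (by omega)).2 hcut.2))
      (cleanCut_le (by omega) ((hclean _ (by omega)).1 hcut'.2))
  -- After its last entry into the rings `≥ c`, a right path avoids ring `c - 1`, so the entry point
  -- in ring `c` stays right.
  · have hupper : rightReach (reroute p G (c - 1)) ≤ c := by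
      obtain ⟨v, hv, hvb⟩ := exists_of_rightReach_lt (p := p) (by omega)
      obtain ⟨t, ht, h1, h2⟩ := id hv
      obtain ⟨x, hx, hxc, hxd⟩ : ∃ x, Anc p v x ∧ (x.2 : ℕ) = c ∧ ¬ Dips p c x := by
        rcases hp.not_dips_or_exists ht h1 (c := c) (by omega) with h | h
        · exact absurd ⟨v, Anc.refl v, by omega⟩ h
        · exact h
      have := rightReach_le (endsAt_reroute (G := G) (c := c - 1) (hv.anc hx)
        fun y hy h => hxd ⟨y, hy, by omega⟩)
      omega
    refine le_antisymm hupper ?_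
    -- A right path from below `c` would have to cross ring `c - 1`, whose vertices now all lead
    -- left.
    obtain ⟨v, hv, hvb⟩ := exists_of_rightReach_lt (p := reroute p G (c - 1)) (by omega)
    by_contra! hlt
    have hr : EndsAt p (m - 1) v := (hp.endsAt_or v).resolve_left fun h => by
      have := (hleft v h).unique hv
      omega
    obtain ⟨t, ht, h1, h2⟩ := id hr
    obtain ⟨x, hx, hxc⟩ := hp.exists_anc_level ht (j := c - 1) (by omega)
    obtain ⟨y, hy, -, hvy⟩ := exists_anc_reroute (p := p) hg hx hxc
    have := ((hleft y hy).of_anc hvy).unique hv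
    omega

end Surgery

/-! ### Counting and exponential tails -/

-- Given `q`, only the ring `d q` of `p` is unknown. A parent there is the sink or is determined by
-- its angle and its ring mod 3, as it is at most one ring away: `3 * n + 1` options for each of `n`
-- vertices.
open Classical in
theorem card_parentMap_le {n m : ℕ} (X Y : Finset (ParentMap n m)) (d : ParentMap n m → ℕ)
    (h : ∀ p ∈ X, IsArborescence p ∧ ∃ q ∈ Y, ∀ v, (v.2 : ℕ) ≠ d q → p v = q v) :
    X.card ≤ (3 * n + 1) ^ n * Y.card := by
  let code : ℕ → ParentMap n m → (Fin n → Option (Fin n × Fin 3)) := fun k p i =>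
    if hk : k < m then (p (i, ⟨k, hk⟩)).map fun w => (w.1, Fin.ofNat 3 w.2) else none
  have hcode : Fintype.card (Fin n → Option (Fin n × Fin 3)) = (3 * n + 1) ^ n := by
    simp [Nat.mul_comm]
  choose hX q hq using h
  rw [← hcode, ← Finset.card_univ, ← Finset.card_product, ← Finset.card_attach]
  refine Finset.card_le_card_of_injOn
    (fun p => (code (d (q p.1 p.2)) p.1, q p.1 p.2)) (fun p _ => ?_) ?_
  · simpa using (hq p.1 p.2).1
  · rintro ⟨p, hp⟩ - ⟨p', hp'⟩ - heq
    simp only [Prod.mk.injEq] at heq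
    obtain ⟨h1, h2⟩ := heq
    refine Subtype.ext (funext fun v => ?_)
    by_cases hv : (v.2 : ℕ) = d (q p hp)
    · obtain ⟨i, j⟩ := v
      have h3 := congrFun h1 i
      rw [← h2] at h3
      simp only at hv
      simp only [code, ← hv, j.isLt, dif_pos, Fin.eta] at h3
      change p (i, j) = p' (i, j)
      rcases hu : p (i, j) with _ | u <;> rcases hu' : p' (i, j) with _ | u'
      · rfl
      · simp [hu, hu'] at h3
      · simp [hu, hu'] at h3
      · have l1 := (hX p hp).level hu
        have l2 := (hX p' hp').level hu'
        simp only [hu, hu', Option.map_some, Option.some.injEq, Prod.mk.injEq] at h3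
        obtain ⟨h4, h5⟩ := h3
        have h6 := congrArg Fin.val h5
        simp only [Fin.ofNat] at h6
        simp only at l1 l2
        exact congrArg some (Prod.ext h4 (Fin.ext (by omega)))
    · exact ((hq p hp).2 v hv).trans (h2 ▸ ((hq p' hp').2 v (h2 ▸ hv)).symm)

/-- A decreasing sequence of sizes that are comparable to their decrements decays geometrically. -/
theorem geometric_decay {f : ℕ → ℝ} {M : ℝ} (hM : 0 ≤ M) (hf : ∀ i, f (i + 1) ≤ M * (f i - f (i + 1)))
    (i : ℕ) : f i ≤ (M / (M + 1)) ^ i * f 0 := by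
  induction i with
  | zero => simp
  | succ i ih =>
    have h1 : f (i + 1) ≤ M / (M + 1) * f i := by
      rw [div_mul_eq_mul_div, le_div_iff₀ (by linarith)]
      linarith [hf i]
    calc f (i + 1) ≤ M / (M + 1) * f i := h1
      _ ≤ M / (M + 1) * ((M / (M + 1)) ^ i * f 0) :=
        mul_le_mul_of_nonneg_left ih (div_nonneg hM (by linarith))
      _ = _ := by ring

open Classical in
/-- The arborescences of the cylinder. -/
noncomputable def arborescences (n m : ℕ) : Finset (ParentMap n m) :=
  Finset.univ.filter IsArborescence

open Classical in
theorem card_cleanCut_le {n m : ℕ} (hm : 2 ≤ m) (i : ℕ) :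
    (((arborescences n m).filter fun p => i ≤ cleanCut p - leftReach p).card : ℝ) ≤
      (((3 * n + 1) ^ n : ℝ) / ((3 * n + 1) ^ n + 1)) ^ i * (arborescences n m).card := by
  set f : ℕ → ℝ := fun i => ((arborescences n m).filter fun p => i ≤ cleanCut p - leftReach p).card
  have h0 : f 0 = (arborescences n m).card := by simp [f]
  rw [← h0]
  refine geometric_decay (f := f) (by positivity) (fun i => ?_) i
  have key := card_parentMap_le
    ((arborescences n m).filter fun p => i + 1 ≤ cleanCut p - leftReach p)
    ((arborescences n m).filter fun p => cleanCut p - leftReach p = i)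
    (fun q => cleanCut q) (by
      intro p hp
      simp only [arborescences, Finset.mem_filter, Finset.mem_univ, true_and] at hp
      obtain ⟨q, h1, h2, h3, h4⟩ := exists_cleanCut_eq hm hp.1 (c := leftReach p + i) (by omega)
        (by omega)
      refine ⟨hp.1, q, ?_, fun v hv => h4 v (h3 ▸ hv)⟩
      simp only [arborescences, Finset.mem_filter, Finset.mem_univ, true_and]
      exact ⟨h1, by omega⟩)
  have hsplit : ((arborescences n m).filter fun p => i ≤ cleanCut p - leftReach p).card =
      ((arborescences n m).filter fun p => i + 1 ≤ cleanCut p - leftReach p).card +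
      ((arborescences n m).filter fun p => cleanCut p - leftReach p = i).card := by
    rw [← Finset.card_union_of_disjoint]
    · congr 1
      ext p
      simp only [Finset.mem_union, Finset.mem_filter, ← and_or_left]
      exact and_congr_right fun _ => by omega
    · exact Finset.disjoint_filter.2 fun _ _ h => by omega
  have key' : f (i + 1) ≤ ((3 * n + 1) ^ n : ℝ) *
      ((arborescences n m).filter fun p => cleanCut p - leftReach p = i).card := by
    simp only [f]
    exact_mod_cast key
  have hsplit' : f i = f (i + 1) +
      ((arborescences n m).filter fun p => cleanCut p - leftReach p = i).card := by
    simp only [f]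
    exact_mod_cast hsplit
  rw [hsplit']
  simpa using key'

open Classical in
theorem card_overlap_le {n m : ℕ} (hm : 2 ≤ m) {i : ℕ} (hi : 1 ≤ i) :
    (((arborescences n m).filter fun p =>
      i + i ≤ cleanCut p - rightReach p ∧ cleanCut p - leftReach p ≤ i).card : ℝ) ≤
      (((3 * n + 1) ^ n : ℝ) / ((3 * n + 1) ^ n + 1)) ^ i * (arborescences n m).card := by
  set f : ℕ → ℝ := fun j => ((arborescences n m).filter fun p =>
      i + j ≤ cleanCut p - rightReach p ∧ cleanCut p - leftReach p ≤ i).card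
  have h0 : f 0 ≤ (arborescences n m).card := by
    simp only [f]
    exact_mod_cast Finset.card_le_card (Finset.filter_subset _ _)
  refine (geometric_decay (f := f) (M := (3 * n + 1) ^ n) (by positivity) (fun j => ?_) i).trans
    (mul_le_mul_of_nonneg_left h0 (by positivity))
  have key := card_parentMap_le
    ((arborescences n m).filter fun p =>
      i + (j + 1) ≤ cleanCut p - rightReach p ∧ cleanCut p - leftReach p ≤ i)
    ((arborescences n m).filter fun p =>
      cleanCut p - rightReach p = i + j ∧ cleanCut p - leftReach p ≤ i)
    (fun q => rightReach q - 1) (by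
      intro p hp
      simp only [arborescences, Finset.mem_filter, Finset.mem_univ, true_and] at hp
      have := cleanCut_le_self p
      -- The bound on `cleanCut p - leftReach p` puts this ring at most at `leftReach p`; `1 ≤ i`
      -- puts it below `m`.
      obtain ⟨q, h1, h2, h3, h4, h5⟩ := exists_rightReach_eq hm hp.1
        (c := cleanCut p - (i + j)) (by omega) (by omega) (by omega)
      refine ⟨hp.1, q, ?_, fun v hv => h5 v (h4 ▸ hv)⟩
      simp only [arborescences, Finset.mem_filter, Finset.mem_univ, true_and]
      exact ⟨h1, by omega⟩)
  have hsplit : ((arborescences n m).filter fun p =>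
      i + j ≤ cleanCut p - rightReach p ∧ cleanCut p - leftReach p ≤ i).card =
      ((arborescences n m).filter fun p =>
        i + (j + 1) ≤ cleanCut p - rightReach p ∧ cleanCut p - leftReach p ≤ i).card +
      ((arborescences n m).filter fun p =>
        cleanCut p - rightReach p = i + j ∧ cleanCut p - leftReach p ≤ i).card := by
    rw [← Finset.card_union_of_disjoint]
    · congr 1
      ext p
      simp only [Finset.mem_union, Finset.mem_filter, ← and_or_left]
      exact and_congr_right fun _ => by omega
    · exact Finset.disjoint_filter.2 fun _ _ h => by omega
  have key' : f (j + 1) ≤ ((3 * n + 1) ^ n : ℝ) *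
      ((arborescences n m).filter fun p =>
        cleanCut p - rightReach p = i + j ∧ cleanCut p - leftReach p ≤ i).card := by
    simp only [f]
    exact_mod_cast key
  have hsplit' : f j = f (j + 1) +
      ((arborescences n m).filter fun p =>
        cleanCut p - rightReach p = i + j ∧ cleanCut p - leftReach p ≤ i).card := by
    simp only [f]
    exact_mod_cast hsplit
  rw [hsplit']
  simpa using key'

open Classical in
/-- The number of rings in which the two segments overlap has an exponential tail. -/
theorem card_leftReach_sub_rightReach_le (n m i : ℕ) :
    (((arborescences n m).filter fun p => 2 * i ≤ leftReach p - rightReach p).card : ℝ) ≤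
      2 * (((3 * n + 1) ^ n : ℝ) / ((3 * n + 1) ^ n + 1)) ^ i * (arborescences n m).card := by
  set r : ℝ := ((3 * n + 1) ^ n : ℝ) / ((3 * n + 1) ^ n + 1) with hr
  have hr0 : 0 ≤ r := by positivity
  have hr1 : r ≤ 1 := by
    rw [hr, div_le_one (by positivity)]
    linarith
  have hN : (0 : ℝ) ≤ (arborescences n m).card := by positivity
  rcases Nat.eq_zero_or_pos i with rfl | hi
  · simp
    linarith
  rcases Nat.lt_or_ge m 2 with hm | hm
  · have : ((arborescences n m).filter fun p => 2 * i ≤ leftReach p - rightReach p) = ∅ := by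
      refine Finset.filter_false_of_mem fun p _ => ?_
      have : leftReach p ≤ m := leftReach_le fun v _ => v.2.isLt
      omega
    rw [this]
    simp
    positivity
  have hsub : ((arborescences n m).filter fun p => 2 * i ≤ leftReach p - rightReach p) ⊆
      ((arborescences n m).filter fun p =>
        i + i ≤ cleanCut p - rightReach p ∧ cleanCut p - leftReach p ≤ i) ∪
      ((arborescences n m).filter fun p => i ≤ cleanCut p - leftReach p) := by
    intro p
    simp only [Finset.mem_union, Finset.mem_filter, ← and_or_left]
    refine And.imp_right fun _ => ?_
    have := (cleanCut_spec p).1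
    omega
  have h1 := (Finset.card_le_card hsub).trans (Finset.card_union_le _ _)
  have h2 : (((arborescences n m).filter fun p => 2 * i ≤ leftReach p - rightReach p).card : ℝ) ≤
      ((arborescences n m).filter fun p =>
        i + i ≤ cleanCut p - rightReach p ∧ cleanCut p - leftReach p ≤ i).card +
      ((arborescences n m).filter fun p => i ≤ cleanCut p - leftReach p).card := by
    exact_mod_cast h1
  have h3 := card_overlap_le (n := n) hm hi
  have h4 := card_cleanCut_le (n := n) hm i
  linarith

/-! ### Parent maps versus spanning trees -/

/-- The graph on the cylinder with a sink whose edges join every vertex to its parent. -/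
def parentGraph {n m : ℕ} (p : ParentMap n m) : SimpleGraph (WiredVertex n m) :=
  SimpleGraph.fromRel fun x y => ∃ v, x = some v ∧ y = p v

namespace IsArborescence

variable {n m : ℕ} {p q : ParentMap n m}

theorem parentGraph_adj (hp : IsArborescence p) (v : CylVertex n m) :
    (parentGraph p).Adj (some v) (p v) := by
  rw [parentGraph, SimpleGraph.fromRel_adj]
  exact ⟨(hp.adj v).ne, Or.inl ⟨v, rfl, rfl⟩⟩

theorem parentGraph_le (hp : IsArborescence p) : parentGraph p ≤ wiredCylinder n m := by
  intro x y h
  rw [parentGraph, SimpleGraph.fromRel_adj] at h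
  rcases h with ⟨-, ⟨v, rfl, rfl⟩ | ⟨v, rfl, rfl⟩⟩
  · exact hp.adj v
  · exact (hp.adj v).symm

theorem parentGraph_connected (hp : IsArborescence p) : (parentGraph p).Connected := by
  have key : ∀ x, (parentGraph p).Reachable x none := by
    rintro (_ | v)
    · exact SimpleGraph.Reachable.refl _
    · obtain ⟨w, hw, h⟩ := hp.rooted v
      induction hw using Relation.ReflTransGen.head_induction_on with
      | refl => exact (h ▸ hp.parentGraph_adj w).reachable
      | @head a b hab _ ih =>
        have hab' : p a = some b := hab
        have := hp.parentGraph_adj a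
        rw [hab'] at this
        exact this.reachable.trans ih
  have : Nonempty (WiredVertex n m) := ⟨none⟩
  exact ⟨fun x y => (key x).trans (key y).symm⟩

theorem parentGraph_isTree (hp : IsArborescence p) : (parentGraph p).IsTree := by
  rw [SimpleGraph.isTree_iff_connected_and_card]
  refine ⟨hp.parentGraph_connected, le_antisymm ?_
    hp.parentGraph_connected.card_vert_le_card_edgeSet_add_one⟩
  -- Each non-sink vertex contributes at most one edge.
  have hsub : (parentGraph p).edgeSet ⊆ Set.range fun v => s(some v, p v) := by
    intro e
    induction e with
    | _ x y =>
      intro h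
      rw [SimpleGraph.mem_edgeSet, parentGraph, SimpleGraph.fromRel_adj] at h
      rcases h with ⟨-, ⟨v, rfl, rfl⟩ | ⟨v, rfl, rfl⟩⟩
      · exact ⟨v, rfl⟩
      · exact ⟨v, Sym2.eq_swap⟩
  have h1 : Nat.card (parentGraph p).edgeSet ≤ Nat.card (CylVertex n m) :=
    (Nat.card_mono (Set.toFinite _) hsub).trans (Finite.card_range_le _)
  have h2 : Nat.card (WiredVertex n m) = Nat.card (CylVertex n m) + 1 := Finite.card_option
  omega

/-- Induct outward from the root: an edge oriented oppositely by `p` and `q` would, by agreement at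
the parent, give a 2-cycle of `p`. -/
theorem eq_of_parentGraph_eq (hp : IsArborescence p)
    (h : parentGraph p = parentGraph q) : p = q := by
  have hadj : ∀ v, q v = p v ∨ ∃ w, p v = some w ∧ q w = some v := by
    intro v
    have := hp.parentGraph_adj v
    rw [h, parentGraph, SimpleGraph.fromRel_adj] at this
    rcases this with ⟨-, ⟨w, hw, hw'⟩ | ⟨w, hw, hw'⟩⟩
    · cases hw; exact Or.inl hw'.symm
    · exact Or.inr ⟨w, hw, hw'.symm⟩
  funext v
  obtain ⟨t, ht, h0⟩ := hp.rooted v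
  induction ht using Relation.ReflTransGen.head_induction_on with
  | refl =>
    rcases hadj t with h' | ⟨w, h', -⟩
    · exact h'.symm
    · rw [h0] at h'; cases h'
  | @head a b hab hbt ih =>
    rcases hadj a with h' | ⟨w, hw, hw'⟩
    · exact h'.symm
    · have hab' : p a = some b := hab
      have hwb : w = b := Option.some.inj (hw.symm.trans hab')
      subst hwb
      have hwa : p w = some a := ih.trans hw'
      have hcycle : ∀ x, Anc p a x → x = a ∨ x = w := by
        intro x hx
        induction hx with
        | refl => exact Or.inl rfl
        | tail _ hyx ih =>
          rcases ih with rfl | rfl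
          · exact Or.inr (Option.some.inj (hyx.symm.trans hab'))
          · exact Or.inl (Option.some.inj (hyx.symm.trans hwa))
      rcases hcycle t (Anc.head hab' hbt) with rfl | rfl
      · rw [hab'] at h0; cases h0
      · rw [hwa] at h0; cases h0

end IsArborescence

/-- Every spanning tree comes from an arborescence, whose paths to the sink are those of the
tree. -/
theorem exists_isArborescence {n m : ℕ} {T : SimpleGraph (WiredVertex n m)}
    (hT : T ∈ spanningTrees (wiredCylinder n m)) :
    ∃ p, IsArborescence p ∧ parentGraph p = T ∧
      ∀ k v, some v ∈ segmentThrough (ring n m k) T → EndsAt p k v := by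
  obtain ⟨hle, htree⟩ := hT
  choose P hP hPu using fun v : CylVertex n m => htree.existsUnique_path (some v) none
  set p : ParentMap n m := fun v => (P v).snd with hpdef
  have hcons : ∀ (v : CylVertex n m) (y : WiredVertex n m) (h : T.Adj (some v) y)
      (q : T.Walk y none), (SimpleGraph.Walk.cons h q).IsPath → p v = y := by
    intro v y h q hq
    have := hPu v _ hq
    simp only [hpdef, ← this, SimpleGraph.Walk.snd_cons]
  have hadj : ∀ v, T.Adj (some v) (p v) := fun v =>
    (P v).adj_snd (SimpleGraph.Walk.not_nil_of_ne (by simp))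
  have key : ∀ (x : WiredVertex n m) (q : T.Walk x none), q.IsPath → ∀ v, x = some v →
      ∃ w, q.penultimate = some w ∧ Anc p v w ∧ p w = none := by
    intro x q
    generalize hs : (none : WiredVertex n m) = s at q
    induction q with
    | nil =>
      rintro - v rfl
      cases hs
    | @cons x y z h q ih =>
      subst hs
      rintro hq v rfl
      have hpv := hcons v y h q hq
      rcases y with _ | u
      · have hnil : q = SimpleGraph.Walk.nil := by
          exact (SimpleGraph.Walk.isPath_iff_nil.1 hq.of_cons).eq_nil
        subst hnil
        exact ⟨v, rfl, Anc.refl v, hpv⟩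
      · obtain ⟨w, hw, hvw, h0⟩ := ih rfl hq.of_cons u rfl
        refine ⟨w, ?_, Anc.head hpv hvw, h0⟩
        rw [SimpleGraph.Walk.penultimate_cons_of_not_nil _ _
          (SimpleGraph.Walk.not_nil_of_ne (by simp)), hw]
  have hp : IsArborescence p := by
    refine ⟨fun v => hle (hadj v), fun v => ?_⟩
    obtain ⟨w, -, h1, h2⟩ := key _ (P v) (hP v) v rfl
    exact ⟨w, h1, h2⟩
  refine ⟨p, hp, ?_, ?_⟩
  · have hpT : parentGraph p ≤ T := by
      intro x y h
      rw [parentGraph, SimpleGraph.fromRel_adj] at h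
      rcases h with ⟨-, ⟨v, rfl, rfl⟩ | ⟨v, rfl, rfl⟩⟩
      · exact hadj v
      · exact (hadj v).symm
    -- A tree is minimal among connected graphs, so a connected subgraph is all of it.
    exact le_antisymm hpT
      ((SimpleGraph.isTree_iff_minimal_connected.1 htree).2 hp.parentGraph_connected hpT)
  · rintro k v ⟨q, hq, w, hw, hqw⟩
    obtain ⟨w', h1, h2, h3⟩ := key _ q hq v rfl
    rw [hqw] at h1
    cases h1
    exact ⟨w, h2, h3, hw⟩

/-! ### From the overlap to the slash -/

theorem none_notMem_segmentThrough {n m : ℕ} (R : Set (Fin n × Fin m))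
    (T : SimpleGraph (WiredVertex n m)) : none ∉ segmentThrough R T := by
  rintro ⟨q, hq, w, -, h⟩
  rw [(SimpleGraph.Walk.isPath_iff_nil.1 hq).eq_nil] at h
  cases h

theorem ncard_slashLR_le {n m : ℕ} {T : SimpleGraph (WiredVertex n m)} {p : ParentMap n m}
    (h : ∀ k v, some v ∈ segmentThrough (ring n m k) T → EndsAt p k v) :
    (slashLR T).ncard ≤ 3 * n ^ 2 * (leftReach p + 1 - rightReach p) := by
  let vert : Fin n → ℕ → WiredVertex n m := fun i k =>
    if hk : k < m then some (i, ⟨k, hk⟩) else none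
  have hvert : ∀ (i : Fin n) (j : Fin m) (k : ℕ), k = j → vert i k = some (i, j) := by
    rintro i j k rfl
    simp [vert]
  -- An edge is coded by two angles, the ring of its left end counted from `rightReach p - 1`, and
  -- the ring difference shifted by one.
  let f : (Fin n × Fin n) × (Fin (leftReach p + 1 - rightReach p) × Fin 3) →
      Sym2 (WiredVertex n m) := fun a =>
    s(vert a.1.1 (rightReach p + a.2.1 - 1), vert a.1.2 (rightReach p + a.2.1 - 1 + a.2.2 - 1))
  have hsub : slashLR T ⊆ Set.range f := by
    rintro e ⟨he, x, hx, y, hy, rfl⟩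
    rcases x with _ | ⟨i, j⟩
    · exact absurd hx (none_notMem_segmentThrough _ _)
    rcases y with _ | ⟨i', j'⟩
    · exact absurd hy (none_notMem_segmentThrough _ _)
    have hl := wiredCylinder_adj_some_level ((SimpleGraph.mem_edgeSet _).1 he)
    have h1 := lt_leftReach (h 0 _ hx)
    have h2 := rightReach_le (h (m - 1) _ hy)
    simp only at hl h1 h2
    refine ⟨((i, i'), (⟨j + 1 - rightReach p, by omega⟩, ⟨j' + 1 - j, by omega⟩)), ?_⟩
    simp only [f]
    rw [hvert i j _ (by omega), hvert i' j' _ (by omega)]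
  refine (Set.ncard_le_ncard hsub (Set.toFinite _)).trans ?_
  rw [← Nat.card_coe_set_eq]
  refine (Finite.card_range_le f).trans (le_of_eq ?_)
  simp
  ring

theorem card_arborescences_le {n m : ℕ} {S : Finset (SimpleGraph (WiredVertex n m))}
    (hS : ∀ T ∈ spanningTrees (wiredCylinder n m), T ∈ S) :
    (arborescences n m).card ≤ S.card := by
  refine Finset.card_le_card_of_injOn parentGraph (fun p hp => ?_) fun p hp q hq h => ?_
  · simp only [arborescences, Finset.coe_filter, Finset.mem_univ, true_and, Set.mem_ofPred_eq] at hp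
    exact Finset.mem_coe.2 (hS _ ⟨hp.parentGraph_le, hp.parentGraph_isTree⟩)
  · simp only [arborescences, Finset.coe_filter, Finset.mem_univ, true_and, Set.mem_ofPred_eq] at hp
    exact hp.eq_of_parentGraph_eq h

open Classical in
theorem toReal_toOuterMeasure_uniformOfFinset_le {α : Type*} {S : Finset α} (hS : S.Nonempty)
    (t : Set α) {c : ℝ} (h : ((S.filter fun x => x ∈ t).card : ℝ) ≤ c * S.card) :
    ((PMF.uniformOfFinset S hS).toOuterMeasure t).toReal ≤ c := by
  rw [PMF.toOuterMeasure_uniformOfFinset_apply, ENNReal.toReal_div, ENNReal.toReal_natCast,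
    ENNReal.toReal_natCast]
  exact (div_le_iff₀ (Nat.cast_pos.2 (Finset.card_pos.2 hS))).2 h

open Classical in
theorem ust_slashLR_le (n m i : ℕ) (l : ℝ)
    (hi : ∀ k : ℕ, l < 3 * n ^ 2 * ((k + 1 : ℕ) : ℝ) → 2 * i ≤ k) :
    ((ust (wiredCylinder n m) (wiredCylinder_connected n m)).toOuterMeasure
        {T | l < ((slashLR T).ncard : ℝ)}).toReal ≤
      2 * (((3 * n + 1) ^ n : ℝ) / ((3 * n + 1) ^ n + 1)) ^ i := by
  refine toReal_toOuterMeasure_uniformOfFinset_le _ _ ?_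
  have h1 : ∀ S : Finset (SimpleGraph (WiredVertex n m)),
      (∀ T ∈ S, T ∈ spanningTrees (wiredCylinder n m) ∧ l < ((slashLR T).ncard : ℝ)) →
      (S.card : ℝ) ≤
        ((arborescences n m).filter fun p => 2 * i ≤ leftReach p - rightReach p).card := by
    intro S hS
    refine Nat.cast_le.2 (Finset.card_le_card_of_surjOn parentGraph fun T hT => ?_)
    obtain ⟨hT, hlT⟩ := hS T hT
    obtain ⟨p, hp, hpT, hseg⟩ := exists_isArborescence hT
    refine ⟨p, ?_, hpT⟩
    rw [Finset.mem_coe, arborescences, Finset.filter_filter, Finset.mem_filter]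
    refine ⟨Finset.mem_univ _, hp, hi _ ?_⟩
    have hs : ((slashLR T).ncard : ℝ) ≤
        3 * n ^ 2 * ((leftReach p + 1 - rightReach p : ℕ) : ℝ) := by
      exact_mod_cast ncard_slashLR_le hseg
    refine (hlT.trans_le hs).trans_le (mul_le_mul_of_nonneg_left ?_ (by positivity))
    exact_mod_cast (by omega : leftReach p + 1 - rightReach p ≤ leftReach p - rightReach p + 1)
  refine (h1 _ fun T hT => ?_).trans ((card_leftReach_sub_rightReach_le n m i).trans ?_)
  · rw [Finset.mem_filter] at hT
    exact ⟨(@Set.mem_toFinset _ _ (_) _).1 hT.1, hT.2⟩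
  refine mul_le_mul_of_nonneg_left ?_ (by positivity)
  exact Nat.cast_le.2 (card_arborescences_le fun T hT => (@Set.mem_toFinset _ _ (_) _).2 hT)

theorem theorem3 (n : ℕ) :
    ∃ C : ℝ, 0 < C ∧ ∃ δ : ℝ, 0 < δ ∧ δ < 1 ∧ ∀ (m : ℕ) (l : ℝ), 0 < l →
      ((ust (wiredCylinder n m) (wiredCylinder_connected n m)).toOuterMeasure
        {T | l < ((slashLR T).ncard : ℝ)}).toReal ≤ C * δ ^ l := by
  set r : ℝ := ((3 * n + 1) ^ n : ℝ) / ((3 * n + 1) ^ n + 1) with hr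
  have hr0 : 0 < r := by positivity
  have hr1 : r < 1 := by
    rw [hr, div_lt_one (by positivity)]
    linarith
  -- The `+ 1` keeps `D` positive when `n = 0`.
  set D : ℝ := 3 * n ^ 2 + 1 with hD
  have hD0 : 0 < D := by positivity
  -- The floor below gives `i > l / (2 * D) - 3 / 2`, whence both exponents.
  refine ⟨2 * r ^ (-(3 / 2) : ℝ), by positivity, r ^ (1 / (2 * D)), by positivity,
    Real.rpow_lt_one hr0.le hr1 (by positivity), fun m l hl => ?_⟩
  set i : ℕ := ⌊(l / D - 1) / 2⌋₊
  have hi : ∀ k : ℕ, l < 3 * n ^ 2 * ((k + 1 : ℕ) : ℝ) → 2 * i ≤ k := by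
    intro k hk
    have h1 : l < D * (k + 1) := by
      push_cast at hk
      rw [hD]
      have : (0 : ℝ) ≤ k := k.cast_nonneg
      nlinarith
    have h2 : l / D - 1 < k := by
      rw [sub_lt_iff_lt_add, div_lt_iff₀ hD0]
      linarith
    rcases le_or_gt 0 ((l / D - 1) / 2) with h | h
    · have h3 : (i : ℝ) ≤ (l / D - 1) / 2 := Nat.floor_le h
      have h4 : ((2 * i : ℕ) : ℝ) < k := by
        push_cast
        linarith
      exact (Nat.cast_lt.1 h4).le
    · simp [i, Nat.floor_of_nonpos h.le]
  refine (ust_slashLR_le n m i l hi).trans ?_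
  rw [← hr, mul_assoc, ← Real.rpow_mul hr0.le, ← Real.rpow_add hr0, ← Real.rpow_natCast]
  refine mul_le_mul_of_nonneg_left ?_ (by norm_num)
  refine Real.rpow_le_rpow_of_exponent_ge hr0 hr1.le ?_
  have h3 : (l / D - 1) / 2 < i + 1 := Nat.lt_floor_add_one _
  have h4 : 1 / (2 * D) * l = l / D / 2 := by
    field_simp
  rw [h4]
  linarith
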